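/- All Banach lattices are real. For a Banach lattice $E$, the dual $E^*$ carries the order $f\le g \iff f(x)\le g(x)$ for all $x\ge 0$; with it $E^*$ and the bidual $E^{**}$ are Banach lattices. Let $m\ge 1$ and let $E_1,\dots,E_m,F$ be Banach lattices. An $m$-linear operator $A\colon E_1\times\cdots\times E_m\to F$ is positive if $A(x_1,\dots,x_m)\ge 0$ whenever $x_1,\dots,x_m\ge 0$, and regular if it is a difference of two positive $m$-linear operators (it is then continuous). A Riesz multimorphism is a regular $m$-linear operator $A$ with $|A(x_1,\dots,x_m)|=A(|x_1|,\dots,|x_m|)$ for all $x_1,\dots,x_m$. For a permutation $\rho$ of $\{1,\dots,m\}$, the Aron–Berner extension $AB_m^\rho(A)\colon E_1^{**}\times\cdots\times E_m^{**}\to F^{**}$ of a regular $A$ is defined by $$AB_m^\rho(A)(x_1^{**},\dots,x_m^{**})(y^*)=\big(\overline{x_{\rho(m)}^{**}}\circ\cdots\circ\overline{x_{\rho(1)}^{**}}\big)(y^*\circ A),\qquad y^*\in F^*,$$ where $\overline{x_{\rho(k)}^{**}}$ sends a form $B$ in the variables $x_{\rho(k)},\dots,x_{\rho(m)}$ to the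 form in the remaining variables $x_{\rho(k+1)},\dots,x_{\rho(m)}$ obtained by applying $x_{\rho(k)}^{**}$ to the functional $x_{\rho(k)}\mapsto B$, the remaining variables being fixed. For a Banach lattice $F$ we say that all Aron–Berner extensions of any $F$-valued Riesz multimorphism are Riesz multimorphisms if, for all $m\ge 1$, all Banach lattices $E_1,\dots,E_m$, every Riesz multimorphism $A\colon E_1\times\cdots\times E_m\to F$ and every permutation $\rho$ of $\{1,\dots,m\}$, the operator $AB_m^\rho(A)$ is a Riesz multimorphism. **Proposition.** Let $1<p<\infty$ and let $(F_n)_{n=1}^\infty$ be a sequence of Banach lattices such that, for every $n$, all Aron–Berner extensions of any $F_n$-valued Riesz multimorphism are Riesz multimorphisms. Then all Aron–Berner extensions of any $(\oplus_n F_n)_0$-valued Riesz multimorphism, and of any $(\oplus_n F_n)_p$-valued Riesz multimorphism, are Riesz multimorphisms. Here $$(\oplus_n F_n)_0=\{(x_n): x_n\in F_n,\ \|x_n\|\to 0\},\quad \|(x_n)\|=\sup_n\|x_n\|,$$ $$(\oplus_n F_n)_p=\Big\{(x_n): x_n\in F_n,\ \|(x_n)\|_p=\Big(\sum_n\|x_n\|^p\Big)^{1/p}<\infty\Big\},$$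 both with the coordinatewise order. -/

import Mathlib

open Filter Topology
open scoped ENNReal

universe u v

/-! ### Banach lattices -/

/-- A real Banach lattice: a complete normed vector lattice over `ℝ` whose norm satisfies
`|x| ≤ |y| → ‖x‖ ≤ ‖y‖`. -/
class IsBanachLattice (E : Type u) [NormedAddCommGroup E] [NormedSpace ℝ E] [Lattice E] : Prop
    extends CompleteSpace E, HasSolidNorm E, IsOrderedAddMonoid E, IsOrderedModule ℝ E

instance : IsBanachLattice ℝ where

/-! ### The dual of a Banach lattice as a Banach lattice -/

namespace BanachDual

variable {E : Type u} [NormedAddCommGroup E] [NormedSpace ℝ E] [Lattice E] [IsBanachLattice E]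

theorem apply_le_of_mem (f : StrongDual ℝ E) {x y : E} (hy : y ∈ Set.Icc 0 x) :
    f y ≤ ‖f‖ * ‖x‖ := by
  have h1 : ‖y‖ ≤ ‖x‖ := norm_le_norm_of_abs_le_abs
    (by rw [abs_of_nonneg hy.1, abs_of_nonneg (hy.1.trans hy.2)]; exact hy.2)
  calc f y ≤ ‖f y‖ := Real.le_norm_self _
    _ ≤ ‖f‖ * ‖y‖ := f.le_opNorm y
    _ ≤ ‖f‖ * ‖x‖ := by gcongr

/-- The Riesz–Kantorovich formula on the positive cone: `f⁺ x = sup {f y | 0 ≤ y ≤ x}`. -/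
noncomputable def posFun (f : StrongDual ℝ E) (x : E) : ℝ := sSup (f '' Set.Icc 0 x)

theorem bddAbove_image (f : StrongDual ℝ E) (x : E) : BddAbove (f '' Set.Icc 0 x) := by
  refine ⟨‖f‖ * ‖x‖, ?_⟩
  rintro _ ⟨y, hy, rfl⟩
  exact apply_le_of_mem f hy

theorem le_posFun (f : StrongDual ℝ E) {x y : E} (h0 : 0 ≤ y) (hy : y ≤ x) :
    f y ≤ posFun f x :=
  le_csSup (bddAbove_image f x) ⟨y, ⟨h0, hy⟩, rfl⟩

set_option linter.unusedSectionVars false in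
theorem posFun_le (f : StrongDual ℝ E) {x : E} (hx : 0 ≤ x) {c : ℝ}
    (h : ∀ y, 0 ≤ y → y ≤ x → f y ≤ c) : posFun f x ≤ c := by
  refine csSup_le ⟨_, 0, ⟨le_rfl, hx⟩, rfl⟩ ?_
  rintro _ ⟨y, hy, rfl⟩
  exact h y hy.1 hy.2

theorem posFun_nonneg (f : StrongDual ℝ E) {x : E} (hx : 0 ≤ x) : 0 ≤ posFun f x := by
  simpa using le_posFun f le_rfl hx

theorem posFun_le_norm (f : StrongDual ℝ E) {x : E} (hx : 0 ≤ x) : posFun f x ≤ ‖f‖ * ‖x‖ :=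
  posFun_le f hx fun _ h0 hy => apply_le_of_mem f ⟨h0, hy⟩

theorem posFun_add (f : StrongDual ℝ E) {x y : E} (hx : 0 ≤ x) (hy : 0 ≤ y) :
    posFun f (x + y) = posFun f x + posFun f y := by
  apply le_antisymm
  · refine posFun_le f (add_nonneg hx hy) fun z hz0 hz => ?_
    have h1 : f (z ⊓ x) ≤ posFun f x := le_posFun f (le_inf hz0 hx) inf_le_right
    have h2 : f (z - z ⊓ x) ≤ posFun f y := by
      refine le_posFun f (sub_nonneg.2 inf_le_left) ?_
      rw [sub_le_iff_le_add, ← sub_le_iff_le_add']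
      refine le_inf ?_ ?_
      · exact sub_le_self z hy
      · exact sub_le_iff_le_add.2 hz
    have : f z = f (z ⊓ x) + f (z - z ⊓ x) := by rw [← map_add]; congr 1; abel
    linarith
  · rw [← le_sub_iff_add_le]
    refine posFun_le f hx fun a ha0 ha => ?_
    rw [le_sub_comm]
    refine posFun_le f hy fun b hb0 hb => ?_
    have := le_posFun f (add_nonneg ha0 hb0) (add_le_add ha hb)
    rw [map_add] at this
    linarith

/-- The positive part `f⁺` of a bounded functional `f`: the unique additive extension to `E` of the
function given on the positive cone by the Riesz–Kantorovich formula. -/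
noncomputable def pos (f : StrongDual ℝ E) : StrongDual ℝ E :=
  AddMonoidHom.toRealLinearMap
    { toFun := fun x => posFun f x⁺ - posFun f x⁻
      map_zero' := by simp
      map_add' := fun x y => by
        have h : (x + y)⁺ + (x⁻ + y⁻) = (x + y)⁻ + (x⁺ + y⁺) := by
          have h1 := posPart_sub_negPart (x + y)
          have h2 := posPart_sub_negPart x
          have h3 := posPart_sub_negPart y
          rw [← sub_eq_zero]
          calc _ = ((x + y)⁺ - (x + y)⁻) - (x⁺ - x⁻) - (y⁺ - y⁻) := by abel
            _ = 0 := by rw [h1, h2, h3]; abel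
        have h' := congrArg (posFun f) h
        have hx := posPart_nonneg x
        have hx' := negPart_nonneg x
        have hy := posPart_nonneg y
        have hy' := negPart_nonneg y
        rw [posFun_add f (posPart_nonneg _) (add_nonneg hx' hy'), posFun_add f hx' hy',
          posFun_add f (negPart_nonneg _) (add_nonneg hx hy), posFun_add f hx hy] at h'
        linarith }
    (AddMonoidHomClass.continuous_of_bound _ ‖f‖ fun x => by
      have hp : ‖x⁺‖ ≤ ‖x‖ := norm_le_norm_of_abs_le_abs
        (by rw [abs_of_nonneg (posPart_nonneg x)]; exact sup_le (le_abs_self x) (abs_nonneg x))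
      have hn : ‖x⁻‖ ≤ ‖x‖ := norm_le_norm_of_abs_le_abs
        (by rw [abs_of_nonneg (negPart_nonneg x)]; exact sup_le (neg_le_abs x) (abs_nonneg x))
      have h1 := posFun_le_norm f (posPart_nonneg x)
      have h2 := posFun_le_norm f (negPart_nonneg x)
      have h3 := posFun_nonneg f (posPart_nonneg x)
      have h4 := posFun_nonneg f (negPart_nonneg x)
      have h5 : ‖f‖ * ‖x⁺‖ ≤ ‖f‖ * ‖x‖ := by gcongr
      have h6 : ‖f‖ * ‖x⁻‖ ≤ ‖f‖ * ‖x‖ := by gcongr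
      change ‖posFun f x⁺ - posFun f x⁻‖ ≤ ‖f‖ * ‖x‖
      rw [Real.norm_eq_abs, abs_le]
      constructor <;> linarith)

theorem pos_apply_of_nonneg (f : StrongDual ℝ E) {x : E} (hx : 0 ≤ x) :
    pos f x = posFun f x := by
  change posFun f x⁺ - posFun f x⁻ = _
  rw [posPart_of_nonneg hx, negPart_of_nonneg hx]
  have : posFun f (0 : E) = 0 := by simp [posFun]
  rw [this, sub_zero]

/-- The order of the dual: `f ≤ g` iff `f x ≤ g x` for all `x ≥ 0`. -/
instance instPartialOrder : PartialOrder (StrongDual ℝ E) where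
  le f g := ∀ x : E, 0 ≤ x → f x ≤ g x
  le_refl f x _ := le_rfl
  le_trans f g h hfg hgh x hx := (hfg x hx).trans (hgh x hx)
  le_antisymm f g hfg hgf := by
    ext x
    have hp := le_antisymm (hfg _ (posPart_nonneg x)) (hgf _ (posPart_nonneg x))
    have hn := le_antisymm (hfg _ (negPart_nonneg x)) (hgf _ (negPart_nonneg x))
    rw [← posPart_sub_negPart x, map_sub, map_sub, hp, hn]

theorem le_def {f g : StrongDual ℝ E} : f ≤ g ↔ ∀ x : E, 0 ≤ x → f x ≤ g x := Iff.rfl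

theorem le_pos (f : StrongDual ℝ E) : f ≤ pos f := fun x hx => by
  rw [pos_apply_of_nonneg f hx]
  exact le_posFun f hx le_rfl

theorem pos_nonneg (f : StrongDual ℝ E) : 0 ≤ pos f := fun x hx => by
  rw [pos_apply_of_nonneg f hx]
  exact posFun_nonneg f hx

theorem pos_le {f g : StrongDual ℝ E} (h : f ≤ g) (hg : 0 ≤ g) : pos f ≤ g := fun x hx => by
  rw [pos_apply_of_nonneg f hx]
  refine posFun_le f hx fun y hy0 hy => (h y hy0).trans ?_
  have := hg (x - y) (sub_nonneg.2 hy)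
  rw [map_sub] at this
  simpa using this

instance instIsOrderedAddMonoid : IsOrderedAddMonoid (StrongDual ℝ E) where
  add_le_add_left f g h k x hx := by
    simpa using h x hx

/-- The dual of a Banach lattice is a vector lattice, with `f ⊔ g = (f - g)⁺ + g`. -/
noncomputable instance instLattice : Lattice (StrongDual ℝ E) where
  __ := instPartialOrder
  sup f g := pos (f - g) + g
  le_sup_left f g := by
    rw [← sub_le_iff_le_add]
    exact le_pos _
  le_sup_right f g := le_add_of_nonneg_left (pos_nonneg _)
  sup_le f g h hf hg := by
    rw [← le_sub_iff_add_le]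
    exact pos_le (sub_le_sub_right hf g) (sub_nonneg.2 hg)
  inf f g := -(pos (-f - -g) + -g)
  inf_le_left f g := by
    rw [neg_le, ← sub_le_iff_le_add]
    exact le_pos _
  inf_le_right f g := by
    rw [neg_le]
    exact le_add_of_nonneg_left (pos_nonneg _)
  le_inf f g h hf hg := by
    rw [le_neg, ← le_sub_iff_add_le]
    exact pos_le (sub_le_sub_right (neg_le_neg hf) _) (sub_nonneg.2 (neg_le_neg hg))

theorem abs_apply_le (f : StrongDual ℝ E) (x : E) : |f x| ≤ |f| |x| := by
  have hp := posPart_nonneg x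
  have hn := negPart_nonneg x
  have h1 : f x = f x⁺ - f x⁻ := by rw [← map_sub, posPart_sub_negPart]
  have h2 : |f| |x| = |f| x⁺ + |f| x⁻ := by rw [← map_add, posPart_add_negPart]
  have a1 := le_abs_self f _ hp
  have a2 := le_abs_self f _ hn
  have a3 := neg_le_abs f _ hp
  have a4 := neg_le_abs f _ hn
  simp only [neg_apply] at a3 a4
  rw [h1, h2, abs_le]
  constructor <;> linarith

theorem abs_apply_le_norm (f : StrongDual ℝ E) {x : E} (hx : 0 ≤ x) : |f| x ≤ ‖f‖ * ‖x‖ := by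
  have h : |f| x = posFun (f - -f) x - f x := by
    rw [← pos_apply_of_nonneg _ hx]
    change (pos (f - -f) + -f) x = _
    simp [sub_eq_add_neg]
  rw [h, sub_le_iff_le_add]
  refine posFun_le _ hx fun y hy0 hy => ?_
  have h2 : ‖y + y - x‖ ≤ ‖x‖ := by
    refine norm_le_norm_of_abs_le_abs ?_
    rw [abs_of_nonneg hx, abs_le']
    constructor
    · rw [sub_le_iff_le_add]; exact add_le_add hy hy
    · rw [neg_sub, sub_le_self_iff]; exact add_nonneg hy0 hy0
  have h3 : f (y + y - x) ≤ ‖f‖ * ‖x‖ :=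
    (Real.le_norm_self _).trans ((f.le_opNorm _).trans (by gcongr))
  simp only [map_sub, map_add, sub_neg_eq_add, add_apply] at h3 ⊢
  linarith

/-- The dual of a Banach lattice is a Banach lattice. -/
instance instIsBanachLattice : IsBanachLattice (StrongDual ℝ E) where
  solid f g h := by
    refine ContinuousLinearMap.opNorm_le_bound _ (norm_nonneg _) fun x => ?_
    calc ‖f x‖ ≤ |f| |x| := abs_apply_le f x
      _ ≤ |g| |x| := h _ (abs_nonneg x)
      _ ≤ ‖g‖ * ‖|x|‖ := abs_apply_le_norm g (abs_nonneg x)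
      _ = ‖g‖ * ‖x‖ := by rw [norm_abs_eq_norm]
  smul_le_smul_of_nonneg_left c hc f g h x hx := by
    simpa using mul_le_mul_of_nonneg_left (h x hx) hc
  smul_le_smul_of_nonneg_right f hf c d h x hx := by
    simpa using mul_le_mul_of_nonneg_right h (by simpa using hf x hx)

end BanachDual

/-! ### The direct sums `(⊕ Fₙ)ₚ` and `(⊕ Fₙ)₀` as Banach lattices -/

namespace BanachSum

variable {F : ℕ → Type u} [∀ n, NormedAddCommGroup (F n)] [∀ n, NormedSpace ℝ (F n)]
  [∀ n, Lattice (F n)] [∀ n, IsBanachLattice (F n)]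

set_option linter.unusedSectionVars false in
theorem memℓp_of_norm_le {p : ℝ≥0∞} {x y : ∀ n, F n} (hy : Memℓp y p)
    (h : ∀ n, ‖x n‖ ≤ ‖y n‖) : Memℓp x p := by
  rcases p.trichotomy with (rfl | rfl | hp)
  · refine memℓp_zero ((memℓp_zero_iff.1 hy).subset fun n hn hy0 => hn ?_)
    simpa [hy0] using h n
  · obtain ⟨C, hC⟩ := memℓp_infty_iff.1 hy
    refine memℓp_infty ⟨C, ?_⟩
    rintro _ ⟨n, rfl⟩
    exact (h n).trans (hC ⟨n, rfl⟩)
  · refine memℓp_gen (Summable.of_nonneg_of_le (fun n => by positivity) (fun n => ?_)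
      ((memℓp_gen_iff hp).1 hy))
    exact Real.rpow_le_rpow (norm_nonneg _) (h n) hp.le

theorem memℓp_abs {p : ℝ≥0∞} {x : ∀ n, F n} (hx : Memℓp x p) : Memℓp (fun n => |x n|) p :=
  memℓp_of_norm_le hx fun n => (norm_abs_eq_norm (x n)).le

theorem memℓp_sup {p : ℝ≥0∞} {x y : ∀ n, F n} (hx : Memℓp x p) (hy : Memℓp y p) :
    Memℓp (fun n => x n ⊔ y n) p := by
  refine memℓp_of_norm_le ((memℓp_abs hx).add (memℓp_abs hy)) fun n => ?_
  refine norm_le_norm_of_abs_le_abs ?_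
  have h0 := add_nonneg (abs_nonneg (x n)) (abs_nonneg (y n))
  change |x n ⊔ y n| ≤ |(|x n| + |y n|)|
  rw [abs_of_nonneg h0, abs_le']
  refine ⟨sup_le ?_ ?_, ?_⟩
  · exact (le_abs_self _).trans (le_add_of_nonneg_right (abs_nonneg _))
  · exact (le_abs_self _).trans (le_add_of_nonneg_left (abs_nonneg _))
  · rw [neg_sup]
    exact inf_le_left.trans ((neg_le_abs _).trans (le_add_of_nonneg_right (abs_nonneg _)))

theorem memℓp_inf {p : ℝ≥0∞} {x y : ∀ n, F n} (hx : Memℓp x p) (hy : Memℓp y p) :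
    Memℓp (fun n => x n ⊓ y n) p := by
  have h := (memℓp_sup hx.neg hy.neg).neg
  convert h using 2 with n
  simp [neg_sup]

/-- The coordinatewise lattice structure of `(⊕ Fₙ)ₚ`. -/
instance instLatticeLp {p : ℝ≥0∞} : Lattice (lp F p) where
  le x y := ∀ n, x n ≤ y n
  le_refl x n := le_rfl
  le_trans x y z hxy hyz n := (hxy n).trans (hyz n)
  le_antisymm x y hxy hyx := lp.ext (funext fun n => le_antisymm (hxy n) (hyx n))
  sup x y := ⟨fun n => x n ⊔ y n, memℓp_sup (lp.memℓp x) (lp.memℓp y)⟩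
  inf x y := ⟨fun n => x n ⊓ y n, memℓp_inf (lp.memℓp x) (lp.memℓp y)⟩
  le_sup_left x y n := le_sup_left
  le_sup_right x y n := le_sup_right
  sup_le x y z hx hy n := sup_le (hx n) (hy n)
  inf_le_left x y n := inf_le_left
  inf_le_right x y n := inf_le_right
  le_inf x y z hx hy n := le_inf (hx n) (hy n)

theorem abs_apply {p : ℝ≥0∞} (x : lp F p) (n : ℕ) : |x| n = |x n| := rfl

theorem sup_apply {p : ℝ≥0∞} (x y : lp F p) (n : ℕ) : (x ⊔ y) n = x n ⊔ y n := rfl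

theorem inf_apply {p : ℝ≥0∞} (x y : lp F p) (n : ℕ) : (x ⊓ y) n = x n ⊓ y n := rfl

instance instIsBanachLatticeLp {p : ℝ≥0∞} [Fact (1 ≤ p)] : IsBanachLattice (lp F p) where
  solid x y h := by
    have hn : ∀ n, ‖x n‖ ≤ ‖y n‖ := fun n => norm_le_norm_of_abs_le_abs (h n)
    have hp0 : p ≠ 0 := (zero_lt_one.trans_le Fact.out).ne'
    exact lp.norm_mono hp0 hn
  add_le_add_left x y h z n := add_le_add_left (h n) (z n)
  smul_le_smul_of_nonneg_left c hc x y h n := smul_le_smul_of_nonneg_left (h n) hc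
  smul_le_smul_of_nonneg_right x hx c d h n := smul_le_smul_of_nonneg_right h (hx n)

end BanachSum

/-- `(⊕ Fₙ)₀`: the sequences `(xₙ)` with `‖xₙ‖ → 0`, with the supremum norm. -/
def c0Sum (F : ℕ → Type u) [∀ n, NormedAddCommGroup (F n)] [∀ n, NormedSpace ℝ (F n)] :
    Submodule ℝ (lp F ∞) where
  carrier := {x | Tendsto (fun n => ‖x n‖) atTop (𝓝 0)}
  zero_mem' := by
    change Tendsto (fun n => ‖(0 : F n)‖) atTop (𝓝 0)
    simp
  add_mem' {x y} hx hy := by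
    refine squeeze_zero (fun n => norm_nonneg _) (fun n => norm_add_le (x n) (y n)) ?_
    simpa using hx.add hy
  smul_mem' c x hx := by
    have h : Tendsto (fun n => ‖c‖ * ‖x n‖) atTop (𝓝 (‖c‖ * 0)) := hx.const_mul _
    rw [mul_zero] at h
    refine h.congr fun n => ?_
    exact (norm_smul c (x n)).symm

namespace BanachSum

variable {F : ℕ → Type u} [∀ n, NormedAddCommGroup (F n)] [∀ n, NormedSpace ℝ (F n)]

theorem mem_c0Sum {x : lp F ∞} : x ∈ c0Sum F ↔ Tendsto (fun n => ‖x n‖) atTop (𝓝 0) := Iff.rfl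

theorem isClosed_c0Sum : IsClosed (c0Sum F : Set (lp F ∞)) := by
  refine isClosed_of_closure_subset fun x hx => ?_
  change Tendsto (fun n => ‖x n‖) atTop (𝓝 0)
  rw [Metric.mem_closure_iff] at hx
  rw [Metric.tendsto_atTop]
  intro ε hε
  obtain ⟨y, hy, hxy⟩ := hx (ε / 2) (half_pos hε)
  obtain ⟨N, hN⟩ := Metric.tendsto_atTop.1 (mem_c0Sum.1 hy) (ε / 2) (half_pos hε)
  refine ⟨N, fun n hn => ?_⟩
  have h1 := hN n hn
  rw [dist_eq_norm] at hxy
  have h2 : ‖x n - y n‖ ≤ ‖x - y‖ := lp.norm_apply_le_norm ENNReal.top_ne_zero (x - y) n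
  have h3 : ‖x n‖ ≤ ‖x n - y n‖ + ‖y n‖ := by simpa using norm_add_le (x n - y n) (y n)
  simp only [dist_zero_right, norm_norm] at h1 ⊢
  linarith

variable [∀ n, Lattice (F n)] [∀ n, IsBanachLattice (F n)]

theorem sup_mem_c0Sum {x y : lp F ∞} (hx : x ∈ c0Sum F) (hy : y ∈ c0Sum F) :
    x ⊔ y ∈ c0Sum F := by
  rw [mem_c0Sum] at *
  refine squeeze_zero (fun n => norm_nonneg _) (fun n => norm_sup_le_add (x n) (y n)) ?_
  simpa using hx.add hy

theorem inf_mem_c0Sum {x y : lp F ∞} (hx : x ∈ c0Sum F) (hy : y ∈ c0Sum F) :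
    x ⊓ y ∈ c0Sum F := by
  rw [mem_c0Sum] at *
  refine squeeze_zero (fun n => norm_nonneg _) (fun n => norm_inf_le_add (x n) (y n)) ?_
  simpa using hx.add hy

/-- The coordinatewise lattice structure of `(⊕ Fₙ)₀`, inherited from `(⊕ Fₙ)_∞`. -/
instance instLatticeC0 : Lattice (c0Sum F) :=
  Subtype.lattice (P := fun x => x ∈ c0Sum F) (fun _ _ => sup_mem_c0Sum) (fun _ _ => inf_mem_c0Sum)

instance instIsBanachLatticeC0 : IsBanachLattice (c0Sum F) where
  toCompleteSpace := isClosed_c0Sum.completeSpace_coe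
  solid _ _ h := HasSolidNorm.solid (α := lp F ∞) h
  add_le_add_left _ _ h z := add_le_add_left (α := lp F ∞) h z
  smul_le_smul_of_nonneg_left _ hc _ _ h :=
    smul_le_smul_of_nonneg_left (α := ℝ) (β := lp F ∞) h hc
  smul_le_smul_of_nonneg_right _ hx _ _ h :=
    smul_le_smul_of_nonneg_right (α := ℝ) (β := lp F ∞) h hx

end BanachSum

/-! ### Positive and regular multilinear operators, Riesz multimorphisms -/

section Regular

variable {m : ℕ} {E : Fin m → Type v} {F : Type u}

/-- A multilinear operator is positive if it maps tuples of positive elements to positive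
elements. -/
def IsPositiveMultilinear [∀ i, AddCommGroup (E i)] [∀ i, Module ℝ (E i)] [∀ i, Lattice (E i)]
    [AddCommGroup F] [Module ℝ F] [Lattice F] (A : MultilinearMap ℝ E F) : Prop :=
  ∀ x : ∀ i, E i, (∀ i, 0 ≤ x i) → 0 ≤ A x

/-- A multilinear operator is regular if it is the difference of two positive ones. -/
def IsRegularMultilinear [∀ i, AddCommGroup (E i)] [∀ i, Module ℝ (E i)] [∀ i, Lattice (E i)]
    [AddCommGroup F] [Module ℝ F] [Lattice F] (A : MultilinearMap ℝ E F) : Prop :=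
  ∃ A₁ A₂ : MultilinearMap ℝ E F,
    IsPositiveMultilinear A₁ ∧ IsPositiveMultilinear A₂ ∧ A = A₁ - A₂

/-- A Riesz multimorphism is a regular multilinear operator `A` such that
`|A(x₁, …, xₘ)| = A(|x₁|, …, |xₘ|)` for all `x₁, …, xₘ`. -/
structure IsRieszMultimorphism [∀ i, AddCommGroup (E i)] [∀ i, Module ℝ (E i)]
    [∀ i, Lattice (E i)] [AddCommGroup F] [Module ℝ F] [Lattice F]
    (A : MultilinearMap ℝ E F) : Prop where
  regular : IsRegularMultilinear A
  abs_apply : ∀ x : ∀ i, E i, |A x| = A fun i => |x i|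

end Regular

/-! ### Regular multilinear operators on Banach lattices are continuous -/

namespace RegularMultilinear

variable {m : ℕ} {E : Fin m → Type v} {F : Type u}
  [∀ i, NormedAddCommGroup (E i)] [∀ i, NormedSpace ℝ (E i)] [∀ i, Lattice (E i)]
  [∀ i, IsBanachLattice (E i)]
  [NormedAddCommGroup F] [NormedSpace ℝ F] [Lattice F] [IsBanachLattice F]

theorem positive_mono {A : MultilinearMap ℝ E F} (hA : IsPositiveMultilinear A) {x y : ∀ i, E i}
    (hx : ∀ i, 0 ≤ x i) (hxy : ∀ i, x i ≤ y i) : A x ≤ A y := by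
  have h : y = x + (y - x) := by abel
  rw [h, A.map_add_univ]
  have h1 := Finset.single_le_sum (f := fun s : Finset (Fin m) => A (s.piecewise x (y - x)))
    (s := Finset.univ) (fun s _ => hA _ fun i => by
      by_cases hi : i ∈ s
      · simpa [hi] using hx i
      · simpa [hi] using hxy i) (Finset.mem_univ Finset.univ)
  simpa using h1

theorem positive_bound_unit {A : MultilinearMap ℝ E F} (hA : IsPositiveMultilinear A) :
    ∃ C : ℝ, ∀ x : ∀ i, E i, (∀ i, 0 ≤ x i) → (∀ i, ‖x i‖ ≤ 1) → ‖A x‖ ≤ C := by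
  by_contra! hcon
  choose x hx0 hx1 hxC using fun n : ℕ => hcon (n * (2 ^ n) ^ m)
  have hs : ∀ i, Summable fun n : ℕ => ((1 / 2 : ℝ) ^ n) • x n i := fun i => by
    refine Summable.of_norm_bounded (g := fun n : ℕ => (1 / 2 : ℝ) ^ n) summable_geometric_two
      fun n => ?_
    rw [norm_smul, norm_pow]
    calc ‖(1 / 2 : ℝ)‖ ^ n * ‖x n i‖ ≤ ‖(1 / 2 : ℝ)‖ ^ n * 1 := by gcongr; exact hx1 n i
      _ = (1 / 2 : ℝ) ^ n := by rw [mul_one]; norm_num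
  set y : ∀ i, E i := fun i => ∑' n : ℕ, ((1 / 2 : ℝ) ^ n) • x n i with hy
  have hpos : ∀ n i, 0 ≤ ((1 / 2 : ℝ) ^ n) • x n i := fun n i =>
    smul_nonneg (by positivity) (hx0 n i)
  have hle : ∀ n i, ((1 / 2 : ℝ) ^ n) • x n i ≤ y i := fun n i =>
    (hs i).le_tsum n fun k _ => hpos k i
  obtain ⟨n, hn⟩ := exists_nat_gt ‖A y‖
  have h1 := positive_mono hA (hpos n) (hle n)
  have h2 : ‖A fun i => ((1 / 2 : ℝ) ^ n) • x n i‖ ≤ ‖A y‖ := by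
    refine norm_le_norm_of_abs_le_abs ?_
    have h0 := hA _ (hpos n)
    rwa [abs_of_nonneg h0, abs_of_nonneg (h0.trans h1)]
  rw [A.map_smul_univ, norm_smul] at h2
  have h3 : ‖∏ _i : Fin m, ((1 / 2 : ℝ) ^ n)‖ = ((2 ^ n) ^ m)⁻¹ := by
    simp
  rw [h3] at h2
  have h4 := hxC n
  have h5 : (0 : ℝ) < (2 ^ n) ^ m := by positivity
  have h6 : ‖A (x n)‖ ≤ ‖A y‖ * (2 ^ n) ^ m := by
    rw [inv_mul_le_iff₀ h5] at h2
    linarith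
  have h7 : ‖A y‖ * (2 ^ n) ^ m < n * (2 ^ n) ^ m := by gcongr
  linarith

theorem positive_continuous {A : MultilinearMap ℝ E F} (hA : IsPositiveMultilinear A) :
    Continuous A := by
  obtain ⟨C, hC⟩ := positive_bound_unit hA
  have hC0 : 0 ≤ C := by
    simpa using (norm_nonneg _).trans (hC 0 (fun i => le_rfl) (fun i => by simp))
  have hpos : ∀ x : ∀ i, E i, (∀ i, 0 ≤ x i) → ‖A x‖ ≤ C * ∏ i, ‖x i‖ := fun x hx => by
    have h1 : x = fun i => ‖x i‖ • (‖x i‖⁻¹ • x i) := by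
      funext i
      by_cases h0 : x i = 0
      · simp [h0]
      · rw [smul_smul, mul_inv_cancel₀ (norm_ne_zero_iff.2 h0), one_smul]
    have h2 : ‖A fun i => ‖x i‖⁻¹ • x i‖ ≤ C := by
      refine hC _ (fun i => smul_nonneg (by positivity) (hx i)) fun i => ?_
      rw [norm_smul, norm_inv, norm_norm]
      exact inv_mul_le_one
    conv_lhs => rw [h1]
    rw [A.map_smul_univ, norm_smul, Real.norm_of_nonneg (by positivity), mul_comm]
    gcongr
  refine A.continuous_of_bound ((2 : ℝ) ^ m * C) fun x => ?_
  have hx : x = (fun i => (x i)⁺) + fun i => -(x i)⁻ := by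
    funext i
    simp [← sub_eq_add_neg]
  have hterm : ∀ s : Finset (Fin m),
      ‖A (s.piecewise (fun i => (x i)⁺) fun i => -(x i)⁻)‖ ≤ C * ∏ i, ‖x i‖ := fun s => by
    have h1 : (s.piecewise (fun i => (x i)⁺) fun i => -(x i)⁻) = fun i =>
        (if i ∈ s then (1 : ℝ) else -1) • (if i ∈ s then (x i)⁺ else (x i)⁻) := by
      funext i
      by_cases hi : i ∈ s <;> simp [hi]
    rw [h1, A.map_smul_univ, norm_smul, norm_prod]
    have h2 : ∏ i, ‖(if i ∈ s then (1 : ℝ) else -1)‖ = 1 :=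
      Finset.prod_eq_one fun i _ => by split_ifs <;> simp
    rw [h2, one_mul]
    refine (hpos _ fun i => ?_).trans ?_
    · split_ifs
      · exact posPart_nonneg _
      · exact negPart_nonneg _
    · gcongr with i
      split_ifs
      · refine norm_le_norm_of_abs_le_abs ?_
        rw [abs_of_nonneg (posPart_nonneg (x i))]
        exact sup_le (le_abs_self _) (abs_nonneg _)
      · refine norm_le_norm_of_abs_le_abs ?_
        rw [abs_of_nonneg (negPart_nonneg (x i))]
        exact sup_le (neg_le_abs _) (abs_nonneg _)
  calc ‖A x‖ = ‖∑ s : Finset (Fin m), A (s.piecewise (fun i => (x i)⁺) fun i => -(x i)⁻)‖ := by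
        conv_lhs => rw [hx]
        rw [A.map_add_univ]
    _ ≤ ∑ _s : Finset (Fin m), C * ∏ i, ‖x i‖ :=
        (norm_sum_le _ _).trans (Finset.sum_le_sum fun s _ => hterm s)
    _ = (2 : ℝ) ^ m * C * ∏ i, ‖x i‖ := by
        rw [Finset.sum_const, Finset.card_univ, Fintype.card_finset, Fintype.card_fin, nsmul_eq_mul]
        push_cast
        ring

/-- A regular multilinear operator between Banach lattices, as a continuous multilinear map. -/
def toContinuous (A : MultilinearMap ℝ E F) (hA : IsRegularMultilinear A) :
    ContinuousMultilinearMap ℝ E F where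
  toMultilinearMap := A
  cont := by
    obtain ⟨A₁, A₂, h₁, h₂, rfl⟩ := hA
    exact (positive_continuous h₁).sub (positive_continuous h₂)

end RegularMultilinear

/-! ### Aron–Berner extensions -/

/-- The topological bidual `E**`. -/
abbrev Bidual (E : Type u) [NormedAddCommGroup E] [NormedSpace ℝ E] : Type u :=
  StrongDual ℝ (StrongDual ℝ E)

namespace AronBerner

section Step

variable {m : ℕ} {E : Fin (m + 1) → Type v} [∀ i, NormedAddCommGroup (E i)]
  [∀ i, NormedSpace ℝ (E i)]

/-- For an `(m+1)`-linear form `B`, the map `(x₁, …, xₘ) ↦ B(•, x₁, …, xₘ)` into the dual of the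
space of the first variable, depending linearly and continuously on `B`. -/
noncomputable def functionals :
    ContinuousMultilinearMap ℝ E ℝ →L[ℝ]
      ContinuousMultilinearMap ℝ (fun i : Fin m => E i.succ) (StrongDual ℝ (E 0)) :=
  (ContinuousLinearMap.flipMultilinearEquiv ℝ (fun i : Fin m => E i.succ) (E 0) ℝ
      : _ →L[ℝ] ContinuousMultilinearMap ℝ (fun i : Fin m => E i.succ) (StrongDual ℝ (E 0))) ∘L
    (continuousMultilinearCurryLeftEquiv ℝ E ℝ).toContinuousLinearEquiv.toContinuousLinearMap

theorem functionals_apply (B : ContinuousMultilinearMap ℝ E ℝ) (x : ∀ i : Fin m, E i.succ)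
    (x₀ : E 0) : functionals B x x₀ = B (Fin.cons x₀ x) := rfl

/-- The operator associated with `x''` in the bidual of the space of the first variable, which
eliminates the first variable of an `(m+1)`-linear form:
`elimFirst x'' B (x₁, …, xₘ) = x''(B(•, x₁, …, xₘ))`. -/
noncomputable def elimFirst (x'' : Bidual (E 0)) :
    ContinuousMultilinearMap ℝ E ℝ →L[ℝ]
      ContinuousMultilinearMap ℝ (fun i : Fin m => E i.succ) ℝ :=
  ContinuousLinearMap.compContinuousMultilinearMapL ℝ (fun i : Fin m => E i.succ)
    (StrongDual ℝ (E 0)) ℝ x'' ∘L functionals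

theorem elimFirst_apply (x'' : Bidual (E 0)) (B : ContinuousMultilinearMap ℝ E ℝ)
    (x : ∀ i : Fin m, E i.succ) : elimFirst x'' B x = x'' (functionals B x) := rfl

end Step

/-- For `x''₁, …, x''ₘ` in the biduals, the functional on `m`-linear forms which eliminates the
variables one after the other: first `x''₁` eliminates the first variable, then `x''₂` the second one,
and so on. -/
noncomputable def elimAll : (m : ℕ) → (E : Fin m → Type v) → [∀ i, NormedAddCommGroup (E i)] →
    [∀ i, NormedSpace ℝ (E i)] → (∀ i, Bidual (E i)) →
    ContinuousMultilinearMap ℝ E ℝ →L[ℝ] ℝ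
  | 0, E, _, _, _ => ContinuousMultilinearMap.apply ℝ E ℝ 0
  | m + 1, E, _, _, x'' => elimAll m (fun i => E i.succ) (fun i => x'' i.succ) ∘L elimFirst (x'' 0)

theorem elimAll_succ (m : ℕ) (E : Fin (m + 1) → Type v) [∀ i, NormedAddCommGroup (E i)]
    [∀ i, NormedSpace ℝ (E i)] (x'' : ∀ i, Bidual (E i)) (B : ContinuousMultilinearMap ℝ E ℝ) :
    elimAll (m + 1) E x'' B =
      elimAll m (fun i => E i.succ) (fun i => x'' i.succ) (elimFirst (x'' 0) B) := rfl

theorem elimAll_update_add (m : ℕ) (E : Fin m → Type v) [∀ i, NormedAddCommGroup (E i)]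
    [∀ i, NormedSpace ℝ (E i)] (x'' : ∀ i, Bidual (E i)) (i : Fin m)
    (a b : Bidual (E i)) :
    elimAll m E (Function.update x'' i (a + b)) =
      elimAll m E (Function.update x'' i a) + elimAll m E (Function.update x'' i b) := by
  induction m with
  | zero => exact i.elim0
  | succ m ih =>
    refine ContinuousLinearMap.ext fun B => ?_
    rw [add_apply, elimAll_succ, elimAll_succ, elimAll_succ]
    refine Fin.cases (fun a b => ?_) (fun k a b => ?_) i a b
    · have h : ∀ v : Bidual (E 0), (fun j : Fin m => Function.update x'' 0 v j.succ) =
          fun j : Fin m => x'' j.succ := fun v =>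
        funext fun j => Function.update_of_ne (Fin.succ_ne_zero j) _ _
      rw [h, h, h, Function.update_self, Function.update_self, Function.update_self, ← map_add]
      rfl
    · have h : ∀ v : Bidual (E k.succ), (fun j : Fin m => Function.update x'' k.succ v j.succ) =
          Function.update (fun j => x'' j.succ) k v := fun v => by
        funext j
        by_cases hj : j = k
        · subst hj; simp
        · rw [Function.update_of_ne hj, Function.update_of_ne (by simpa using hj)]
      have h0 : ∀ v : Bidual (E k.succ), Function.update x'' k.succ v 0 = x'' 0 := fun v =>
        Function.update_of_ne (Fin.succ_ne_zero k).symm _ _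
      rw [h, h, h, h0, h0, h0, ih (fun j => E j.succ)]
      rfl

theorem elimAll_update_smul (m : ℕ) (E : Fin m → Type v) [∀ i, NormedAddCommGroup (E i)]
    [∀ i, NormedSpace ℝ (E i)] (x'' : ∀ i, Bidual (E i)) (i : Fin m)
    (c : ℝ) (a : Bidual (E i)) :
    elimAll m E (Function.update x'' i (c • a)) = c • elimAll m E (Function.update x'' i a) := by
  induction m with
  | zero => exact i.elim0
  | succ m ih =>
    refine ContinuousLinearMap.ext fun B => ?_
    rw [smul_apply, elimAll_succ, elimAll_succ]
    refine Fin.cases (fun a => ?_) (fun k a => ?_) i a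
    · have h : ∀ v : Bidual (E 0), (fun j : Fin m => Function.update x'' 0 v j.succ) =
          fun j : Fin m => x'' j.succ := fun v =>
        funext fun j => Function.update_of_ne (Fin.succ_ne_zero j) _ _
      rw [h, h, Function.update_self, Function.update_self, ← map_smul]
      rfl
    · have h : ∀ v : Bidual (E k.succ), (fun j : Fin m => Function.update x'' k.succ v j.succ) =
          Function.update (fun j => x'' j.succ) k v := fun v => by
        funext j
        by_cases hj : j = k
        · subst hj; simp
        · rw [Function.update_of_ne hj, Function.update_of_ne (by simpa using hj)]
      have h0 : ∀ v : Bidual (E k.succ), Function.update x'' k.succ v 0 = x'' 0 := fun v =>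
        Function.update_of_ne (Fin.succ_ne_zero k).symm _ _
      rw [h, h, h0, h0, ih (fun j => E j.succ)]
      rfl

theorem update_permute {m : ℕ} {E : Fin m → Type v}
    (ρ : Equiv.Perm (Fin m)) (x : ∀ i, E i) (k : Fin m) (a : E (ρ k)) :
    (fun j => Function.update x (ρ k) a (ρ j)) = Function.update (fun j => x (ρ j)) k a := by
  funext j
  by_cases hj : j = k
  · subst hj; simp
  · rw [Function.update_of_ne hj, Function.update_of_ne (fun h => hj (ρ.injective h))]

section Permute

variable {m : ℕ} {E : Fin m → Type v} {G : Type u} [∀ i, NormedAddCommGroup (E i)]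
  [∀ i, NormedSpace ℝ (E i)] [NormedAddCommGroup G] [NormedSpace ℝ G]

/-- Reordering of the variables: `permute ρ A` takes its variables in the order
`x_{ρ(1)}, …, x_{ρ(m)}`. -/
def permute (ρ : Equiv.Perm (Fin m)) (A : ContinuousMultilinearMap ℝ E G) :
    ContinuousMultilinearMap ℝ (fun k => E (ρ k)) G where
  toMultilinearMap := MultilinearMap.domDomCongrLinearEquiv' ℝ ℝ E G ρ.symm A.toMultilinearMap
  cont := A.cont.comp (continuous_pi fun j => by
    obtain ⟨k, rfl⟩ := ρ.surjective j
    have h : (fun z : ∀ k, E (ρ k) => (ρ.symm.piCongrLeft' E).symm z (ρ k)) = fun z => z k := by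
      funext z
      exact Equiv.piCongrLeft_apply_apply (P := E) (e := ρ) z k
    rw [h]
    exact continuous_apply k)

/-- `permute ρ A` evaluated at `(x_{ρ(1)}, …, x_{ρ(m)})` is `A(x₁, …, xₘ)`. -/
theorem permute_apply (ρ : Equiv.Perm (Fin m)) (A : ContinuousMultilinearMap ℝ E G)
    (x : ∀ i, E i) : permute ρ A (fun k => x (ρ k)) = A x := by
  change A ((ρ.symm.piCongrLeft' E).symm fun k => x (ρ k)) = A x
  congr 1
  exact (ρ.symm.piCongrLeft' E).symm_apply_apply x

end Permute

end AronBerner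

/-- The Aron–Berner extension `AB^ρ(A) : E₁** × ⋯ × Eₘ** → F**` of `A` associated with the
permutation `ρ`: the value of `AB^ρ(A)(x''₁, …, x''ₘ)` at `y' ∈ F*` is obtained from the `m`-linear
form `y' ∘ A` by eliminating first the variable `x_{ρ(1)}` by means of `x''_{ρ(1)}`, then the variable
`x_{ρ(2)}` by means of `x''_{ρ(2)}`, and so on. -/
noncomputable def aronBerner {m : ℕ} {E : Fin m → Type v} {F : Type u}
    [∀ i, NormedAddCommGroup (E i)] [∀ i, NormedSpace ℝ (E i)] [NormedAddCommGroup F]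
    [NormedSpace ℝ F] (ρ : Equiv.Perm (Fin m)) (A : ContinuousMultilinearMap ℝ E F) :
    MultilinearMap ℝ (fun i => Bidual (E i)) (Bidual F) where
  toFun x'' := AronBerner.elimAll m (fun k => E (ρ k)) (fun k => x'' (ρ k)) ∘L
    ContinuousLinearMap.flip (ContinuousLinearMap.compContinuousMultilinearMapL ℝ
      (fun k => E (ρ k)) F ℝ) (AronBerner.permute ρ A)
  map_update_add' := @fun inst x'' i a b => by
    obtain rfl : inst = instDecidableEqFin m := Subsingleton.elim _ _
    obtain ⟨k, rfl⟩ := ρ.surjective i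
    rw [AronBerner.update_permute, AronBerner.update_permute, AronBerner.update_permute,
      AronBerner.elimAll_update_add, ContinuousLinearMap.add_comp]
  map_update_smul' := @fun inst x'' i c a => by
    obtain rfl : inst = instDecidableEqFin m := Subsingleton.elim _ _
    obtain ⟨k, rfl⟩ := ρ.surjective i
    rw [AronBerner.update_permute, AronBerner.update_permute,
      AronBerner.elimAll_update_smul, ContinuousLinearMap.smul_comp]

theorem aronBerner_apply {m : ℕ} {E : Fin m → Type v} {F : Type u}
    [∀ i, NormedAddCommGroup (E i)] [∀ i, NormedSpace ℝ (E i)] [NormedAddCommGroup F]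
    [NormedSpace ℝ F] (ρ : Equiv.Perm (Fin m)) (A : ContinuousMultilinearMap ℝ E F)
    (x'' : ∀ i, Bidual (E i)) (y' : StrongDual ℝ F) :
    aronBerner ρ A x'' y' =
      AronBerner.elimAll m (fun k => E (ρ k)) (fun k => x'' (ρ k))
        (y'.compContinuousMultilinearMap (AronBerner.permute ρ A)) := rfl

/-- For a Banach lattice `F`: all Aron–Berner extensions of any `F`-valued Riesz multimorphism are
Riesz multimorphisms, regardless of the number `m ≥ 1` of variables and of the Banach lattices
`E₁, …, Eₘ`. -/
def AronBernerExtensionsAreRiesz (F : Type u) [NormedAddCommGroup F] [NormedSpace ℝ F] [Lattice F]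
    [IsBanachLattice F] : Prop :=
  ∀ (m : ℕ) (_ : 1 ≤ m) (E : Fin m → Type v) [∀ i, NormedAddCommGroup (E i)]
    [∀ i, NormedSpace ℝ (E i)] [∀ i, Lattice (E i)] [∀ i, IsBanachLattice (E i)]
    (A : MultilinearMap ℝ E F) (hA : IsRieszMultimorphism A) (ρ : Equiv.Perm (Fin m)),
    IsRieszMultimorphism (E := fun i => Bidual (E i)) (F := Bidual F)
      (aronBerner ρ (RegularMultilinear.toContinuous A hA.regular))

/-! Let `G` be one of the two sums, with coordinates `π n` and inclusions `ι n`. Every functional on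
`G` is the norm limit of its truncations `∑ k < N, (f ∘ ι k) ∘ π k` (`tendsto_sum_coordinates`).
Elements of the bidual are norm continuous and the `ι k` are positive, so the order of `G**` can be
tested on the functionals `f ∘ π n` with `f ≥ 0` (`bidual_le_of_coordinates`).

Since `π n` is a lattice homomorphism, `π n ∘ A` is an `F n`-valued Riesz multimorphism, and the
extension of `A`, evaluated at `f ∘ π n`, is the extension of `π n ∘ A` evaluated at `f`. The
identity for absolute values thus passes from the summands to `G` one coordinate at a time
(`aronBernerExtensionsAreRiesz_of_coordinates`).

Convergence of the truncations rests on `tendsto_norm_comp_tail`: gluing the head of one unit vector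
to the tail of another gives norm at most `κ`, where `κ = 1` for the `c₀`-sum and `κ = 2 ^ (1 / p)`
for the `p`-sum. For `p = 1` the constant would be `2`, and truncations need not converge: the sum
functional on `ℓ₁` is a counterexample. -/

/-! ### Functionals along the tails of a decomposition. -/

/-- If `Q N` are the tail projections of a decomposition of `G` whose head and tail parts combine
with a constant `κ < 2`, then the decomposition is shrinking: every functional vanishes along the
tails in norm. -/
theorem tendsto_norm_comp_tail {G : Type u} [NormedAddCommGroup G] [NormedSpace ℝ G]
    (Q : ℕ → G →L[ℝ] G) (hQQ : ∀ N M, N ≤ M → ∀ x, Q N (Q M x) = Q M x)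
    (hQ1 : ∀ N x, ‖Q N x‖ ≤ ‖x‖) (hQ0 : ∀ x, Tendsto (fun N => Q N x) atTop (𝓝 0))
    {κ : ℝ} (hκ : κ < 2)
    (hQκ : ∀ M x y, ‖x‖ ≤ 1 → ‖y‖ ≤ 1 → ‖(x - Q M x) + Q M y‖ ≤ κ) (f : StrongDual ℝ G) :
    Tendsto (fun N => ‖f ∘L Q N‖) atTop (𝓝 0) := by
  have hanti : Antitone fun N => ‖f ∘L Q N‖ := fun N M hNM => by
    refine ContinuousLinearMap.opNorm_le_bound _ (norm_nonneg _) fun x => ?_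
    calc ‖f (Q M x)‖ = ‖(f ∘L Q N) (Q M x)‖ := by simp [hQQ N M hNM]
      _ ≤ ‖f ∘L Q N‖ * ‖Q M x‖ := (f ∘L Q N).le_opNorm _
      _ ≤ ‖f ∘L Q N‖ * ‖x‖ := by gcongr; exact hQ1 M x
  have hbdd : BddBelow (Set.range fun N => ‖f ∘L Q N‖) :=
    ⟨0, by rintro _ ⟨N, rfl⟩; exact norm_nonneg _⟩
  have hlim := tendsto_atTop_ciInf hanti hbdd
  set c := ⨅ N, ‖f ∘L Q N‖ with hc
  have hcle : ∀ N, c ≤ ‖f ∘L Q N‖ := fun N => ciInf_le hbdd N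
  have hc0 : 0 ≤ c := le_ciInf fun N => norm_nonneg _
  rcases hc0.eq_or_lt with h0 | hcpos
  · rwa [← h0] at hlim
  exfalso
  have hκ0 : 0 ≤ κ := (norm_nonneg _).trans (hQκ 0 0 0 (by simp) (by simp))
  -- If `c > 0`, two nearly norming vectors, one cut off before the other begins, will force `2 (c -
  -- δ) ≤ (c + δ) κ`. Since `κ < 2`, a small `δ` excludes this: the condition is `δ (κ + 2) < c (2 -
  -- κ)`, and `κ + 2 < 4`.
  obtain ⟨δ, hδ, hδ1, hδκ⟩ : ∃ δ : ℝ, 0 < δ ∧ δ < c ∧ (c + δ) * κ < 2 * (c - δ) := by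
    refine ⟨c * (2 - κ) / 8, by nlinarith, by nlinarith, ?_⟩
    nlinarith [mul_pos hcpos (sub_pos.2 hκ)]
  have hex : ∀ N, ∃ x, ‖x‖ ≤ 1 ∧ c - δ < f (Q N x) := fun N => by
    have h : c - δ < ‖f ∘L Q N‖ := by linarith [hcle N]
    obtain ⟨x, hx1, hx⟩ := (f ∘L Q N).exists_lt_apply_of_lt_opNorm h
    rcases le_total 0 (f (Q N x)) with h | h
    · exact ⟨x, hx1.le, by simpa [abs_of_nonneg h] using hx⟩
    · exact ⟨-x, by simpa using hx1.le, by simpa [abs_of_nonpos h] using hx⟩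
  obtain ⟨N, hN⟩ := (hlim.eventually (gt_mem_nhds (show c < c + δ by linarith))).exists
  obtain ⟨x, hx1, hx⟩ := hex N
  have hconv : Tendsto (fun M => f (Q N (x - Q M x))) atTop (𝓝 (f (Q N x))) := by
    have h := ((f ∘L Q N).continuous.tendsto _).comp ((hQ0 x).const_sub x)
    rw [sub_zero] at h
    exact h
  -- `M` is so large that cutting `x` off at `M` keeps its value above `c - δ`; `N ≤ M` ensures that
  -- `Q N` fixes the second block `Q M y`.
  obtain ⟨M, hM, hNM⟩ :=
    ((hconv.eventually (lt_mem_nhds hx)).and (eventually_ge_atTop N)).exists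
  obtain ⟨y, hy1, hy⟩ := hex M
  have h1 : f (Q N ((x - Q M x) + Q M y)) ≤ (c + δ) * κ :=
    calc f (Q N ((x - Q M x) + Q M y)) ≤ ‖(f ∘L Q N) ((x - Q M x) + Q M y)‖ := Real.le_norm_self _
      _ ≤ ‖f ∘L Q N‖ * ‖(x - Q M x) + Q M y‖ := (f ∘L Q N).le_opNorm _
      _ ≤ (c + δ) * κ := by gcongr; exact hQκ M x y hx1 hy1
  rw [map_add, map_add, hQQ N M hNM] at h1
  linarith

/-! ### Positivity of Aron–Berner extensions. -/

namespace AronBerner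

/-- Applying a positive `x''` to the first variable of a positive form leaves a positive form in the
others, so induction applies. -/
theorem elimAll_nonneg (m : ℕ) (E : Fin m → Type v) [∀ i, NormedAddCommGroup (E i)]
    [∀ i, NormedSpace ℝ (E i)] [∀ i, Lattice (E i)] [∀ i, IsBanachLattice (E i)]
    (x'' : ∀ i, Bidual (E i)) (hx : ∀ i, 0 ≤ x'' i) (B : ContinuousMultilinearMap ℝ E ℝ)
    (hB : ∀ x : ∀ i, E i, (∀ i, 0 ≤ x i) → 0 ≤ B x) : 0 ≤ elimAll m E x'' B := by
  induction m with
  | zero => exact hB 0 fun i => i.elim0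
  | succ m ih =>
    rw [elimAll_succ]
    refine ih _ _ (fun i => hx i.succ) _ fun x hx0 => ?_
    rw [elimFirst_apply]
    refine hx 0 (functionals B x) fun x₀ hx₀ => ?_
    rw [functionals_apply]
    exact hB _ fun i => Fin.cases hx₀ hx0 i

end AronBerner

section Extension

variable {m : ℕ} {E : Fin m → Type v} [∀ i, NormedAddCommGroup (E i)] [∀ i, NormedSpace ℝ (E i)]

variable [∀ i, Lattice (E i)] [∀ i, IsBanachLattice (E i)]
  {G : Type u} [NormedAddCommGroup G] [NormedSpace ℝ G] [Lattice G] [IsBanachLattice G]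

/-- A Riesz multimorphism is positive, so this makes its extension regular. -/
theorem isPositiveMultilinear_aronBerner (ρ : Equiv.Perm (Fin m))
    (A : ContinuousMultilinearMap ℝ E G) (hA : IsPositiveMultilinear A.toMultilinearMap) :
    IsPositiveMultilinear (E := fun i => Bidual (E i)) (F := Bidual G) (aronBerner ρ A) := by
  intro x'' hx f hf
  change 0 ≤ aronBerner ρ A x'' f
  rw [aronBerner_apply]
  refine AronBerner.elimAll_nonneg m _ _ (fun k => hx (ρ k)) _ fun x hx0 => hf _ ?_
  -- `permute_apply` needs the argument in the form `z ∘ ρ`; every tuple has this form.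
  obtain ⟨z, rfl⟩ : ∃ z : ∀ i, E i, (fun k => z (ρ k)) = x :=
    ⟨(ρ.symm.piCongrLeft' E).symm x, (ρ.symm.piCongrLeft' E).apply_symm_apply x⟩
  change 0 ≤ AronBerner.permute ρ A fun k => z (ρ k)
  rw [AronBerner.permute_apply]
  refine hA z fun i => ?_
  obtain ⟨k, rfl⟩ := ρ.surjective i
  exact hx0 k

theorem IsRieszMultimorphism.isPositive {A : MultilinearMap ℝ E G}
    (hA : IsRieszMultimorphism A) : IsPositiveMultilinear A := fun x hx => by
  have h := hA.abs_apply x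
  rw [show (fun i => |x i|) = x from funext fun i => abs_of_nonneg (hx i)] at h
  exact h ▸ abs_nonneg _

end Extension


/-! ### Norm convergence of truncated functionals. -/

/-- With `Q N` the identity minus the first `N` coordinate projections, the truncation error of `f`
is exactly `f ∘ Q N`. The hypothesis `hnorm` supplies the gluing constant in coordinates, so that
the `c₀`-sum and the `p`-sum are treated together. -/
theorem tendsto_sum_coordinates {F : ℕ → Type u} [∀ n, NormedAddCommGroup (F n)]
    [∀ n, NormedSpace ℝ (F n)] {G : Type u} [NormedAddCommGroup G] [NormedSpace ℝ G]
    (π : ∀ n, G →L[ℝ] F n) (ι : ∀ n, F n →L[ℝ] G)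
    (hself : ∀ n x, π n (ι n x) = x) (hne : ∀ n k x, n ≠ k → π n (ι k x) = 0)
    (hmono : ∀ x y, (∀ n, ‖π n x‖ ≤ ‖π n y‖) → ‖x‖ ≤ ‖y‖)
    (hsum : ∀ x, Tendsto (fun N => ∑ k ∈ Finset.range N, ι k (π k x)) atTop (𝓝 x))
    {κ : ℝ} (hκ : κ < 2)
    (hnorm : ∀ x y z, ‖x‖ ≤ 1 → ‖y‖ ≤ 1 →
      (∀ n, ‖π n z‖ ≤ ‖π n x‖ ∨ ‖π n z‖ ≤ ‖π n y‖) → ‖z‖ ≤ κ) (f : StrongDual ℝ G) :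
    Tendsto (fun N => ∑ k ∈ Finset.range N, (f ∘L ι k) ∘L π k) atTop (𝓝 f) := by
  let Q : ℕ → G →L[ℝ] G := fun N =>
    ContinuousLinearMap.id ℝ G - ∑ k ∈ Finset.range N, ι k ∘L π k
  have hQ : ∀ N x, Q N x = x - ∑ k ∈ Finset.range N, ι k (π k x) := fun N x => by
    simp [Q]
  have hπQ : ∀ n N x, π n (Q N x) = if n < N then 0 else π n x := fun n N x => by
    rw [hQ, map_sub, map_sum]
    split_ifs with h
    · rw [Finset.sum_eq_single_of_mem n (Finset.mem_range.2 h) fun k _ hk => hne n k _ hk.symm,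
        hself, sub_self]
    · rw [Finset.sum_eq_zero fun k hk => hne n k _ fun h' => h (h' ▸ Finset.mem_range.1 hk),
        sub_zero]
  -- Comparing `x - y` with `0` in `hmono` shows that the coordinates separate points.
  have hext : ∀ x y, (∀ n, π n x = π n y) → x = y := fun x y h => by
    have h0 := hmono (x - y) 0 fun n => by simp [h n]
    rw [norm_zero] at h0
    exact sub_eq_zero.1 (norm_le_zero_iff.1 h0)
  have key := tendsto_norm_comp_tail Q
    (fun N M hNM x => hext _ _ fun n => by
      simp only [hπQ]
      split_ifs <;> first | rfl | omega)
    (fun N x => hmono _ _ fun n => by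
      rw [hπQ]
      split_ifs <;> simp)
    (fun x => by
      have h := (hsum x).const_sub x
      rw [sub_self] at h
      exact h.congr fun N => (hQ N x).symm)
    hκ
    -- The glued vector has the coordinates of `x` below `M` and those of `y` from `M` on.
    (fun M x y hx hy => hnorm x y _ hx hy fun n => by
      rw [map_add, map_sub, hπQ, hπQ]
      split_ifs <;> simp)
    f
  rw [tendsto_iff_norm_sub_tendsto_zero]
  refine key.congr fun N => ?_
  rw [norm_sub_rev]
  congr 1
  ext x
  simp [hQ]

/-! ### Passing from the summands to the sum. -/

section Decomposition

variable {F : ℕ → Type u} [∀ n, NormedAddCommGroup (F n)] [∀ n, NormedSpace ℝ (F n)]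
  [∀ n, Lattice (F n)] [∀ n, IsBanachLattice (F n)]
  {G : Type u} [NormedAddCommGroup G] [NormedSpace ℝ G] [Lattice G] [IsBanachLattice G]

/-- In the presence of coordinates `π n : G → F n` whose sections `ι n` are positive and form a
shrinking decomposition, the order of the bidual of `G` is tested on the functionals `f ∘ π n`. -/
theorem bidual_le_of_coordinates (π : ∀ n, G →L[ℝ] F n) (ι : ∀ n, F n →L[ℝ] G)
    (hι : ∀ n x, 0 ≤ x → 0 ≤ ι n x)
    (hconv : ∀ f : StrongDual ℝ G,
      Tendsto (fun N => ∑ k ∈ Finset.range N, (f ∘L ι k) ∘L π k) atTop (𝓝 f))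
    {S T : Bidual G} (h : ∀ n, ∀ f : StrongDual ℝ (F n), 0 ≤ f → S (f ∘L π n) ≤ T (f ∘L π n)) :
    S ≤ T := by
  intro f hf
  -- The inequality is proved on the truncations of `f`, whose pieces `f ∘ ι k` are positive, and
  -- survives the norm limit.
  refine le_of_tendsto_of_tendsto' ((S.continuous.tendsto f).comp (hconv f))
    ((T.continuous.tendsto f).comp (hconv f)) fun N => ?_
  change S (∑ k ∈ Finset.range N, (f ∘L ι k) ∘L π k) ≤ T (∑ k ∈ Finset.range N, (f ∘L ι k) ∘L π k)
  rw [map_sum, map_sum]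
  exact Finset.sum_le_sum fun k _ => h k _ fun x hx => hf _ (hι k x hx)

theorem IsRieszMultimorphism.comp_latticeHom {m : ℕ} {E : Fin m → Type v}
    [∀ i, NormedAddCommGroup (E i)] [∀ i, NormedSpace ℝ (E i)] [∀ i, Lattice (E i)]
    [∀ i, IsBanachLattice (E i)] {H : Type u} [NormedAddCommGroup H] [NormedSpace ℝ H] [Lattice H]
    [IsBanachLattice H] {A : MultilinearMap ℝ E G} (hA : IsRieszMultimorphism A) (T : G →ₗ[ℝ] H)
    (hT : ∀ x, |T x| = T |x|) : IsRieszMultimorphism (T.compMultilinearMap A) where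
  regular := by
    refine ⟨T.compMultilinearMap A, 0, fun x hx => ?_, fun x _ => le_rfl, (sub_zero _).symm⟩
    change 0 ≤ T (A x)
    rw [← abs_of_nonneg (hA.isPositive x hx), ← hT]
    exact abs_nonneg _
  abs_apply x := by
    change |T (A x)| = T (A _)
    rw [hT, hA.abs_apply]

/-- Precomposition with `π n` turns elements of `G**` into elements of `(F n)**`. It carries the
extension `B` of `A` to the extension `C n` of `π n ∘ A`, where the identity is known. -/
theorem aronBernerExtensionsAreRiesz_of_coordinates (π : ∀ n, G →L[ℝ] F n)
    (ι : ∀ n, F n →L[ℝ] G) (hπ : ∀ n x, |π n x| = π n |x|) (hι : ∀ n x, 0 ≤ x → 0 ≤ ι n x)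
    (hconv : ∀ f : StrongDual ℝ G,
      Tendsto (fun N => ∑ k ∈ Finset.range N, (f ∘L ι k) ∘L π k) atTop (𝓝 f))
    (hF : ∀ n, AronBernerExtensionsAreRiesz.{u, v} (F n)) :
    AronBernerExtensionsAreRiesz.{u, v} G := by
  intro m hm E _ _ _ _ A hA ρ
  set B := aronBerner ρ (RegularMultilinear.toContinuous A hA.regular) with hB
  have hBpos : IsPositiveMultilinear (E := fun i => Bidual (E i)) (F := Bidual G) B :=
    isPositiveMultilinear_aronBerner ρ _ hA.isPositive
  refine ⟨⟨B, 0, hBpos, fun x _ => le_rfl, ?_⟩, fun x'' => ?_⟩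
  · ext x'' f
    exact (sub_zero _).symm
  have hπ0 : ∀ n x, 0 ≤ x → 0 ≤ π n x := fun n x hx => by
    rw [← abs_of_nonneg hx, ← hπ]
    exact abs_nonneg _
  have hAn : ∀ n, IsRieszMultimorphism ((π n : G →ₗ[ℝ] F n).compMultilinearMap A) :=
    fun n => hA.comp_latticeHom _ (hπ n)
  let C : ∀ n, MultilinearMap ℝ (fun i => Bidual (E i)) (Bidual (F n)) := fun n =>
    aronBerner ρ (RegularMultilinear.toContinuous _ (hAn n).regular)
  -- Both sides eliminate the variables of the same scalar form `f ∘ π n ∘ A`.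
  have hC : ∀ n z (f : StrongDual ℝ (F n)), B z (f ∘L π n) = C n z f := fun n z f => rfl
  have hCabs : ∀ n, |C n x''| = C n fun i => |x'' i| := fun n =>
    (hF n m hm E _ (hAn n) ρ).abs_apply x''
  apply le_antisymm
  · refine abs_le'.2 ⟨?_, ?_⟩
    · refine bidual_le_of_coordinates π ι hι hconv fun n f hf => ?_
      rw [hC, hC, ← hCabs]
      exact le_abs_self (C n x'') f hf
    · refine bidual_le_of_coordinates π ι hι hconv fun n f hf => ?_
      rw [hC, ← hCabs, neg_apply, hC]
      exact neg_le_abs (C n x'') f hf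
  · refine bidual_le_of_coordinates π ι hι hconv fun n f hf => ?_
    rw [hC, ← hCabs]
    -- Precomposition with `R` need not be known to preserve absolute values. As `R` is positive,
    -- `|B x''| ∘ R` is an upper bound of `C n x''` and its negative, hence of `|C n x''|`, and this
    -- inequality is all that is needed.
    let R : StrongDual ℝ (F n) →L[ℝ] StrongDual ℝ G := ContinuousLinearMap.precomp ℝ (π n)
    have hR : ∀ f : StrongDual ℝ (F n), 0 ≤ f → 0 ≤ R f := fun f hf x hx => hf _ (hπ0 n x hx)
    have h : |C n x''| ≤ |B x''| ∘L R := by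
      refine abs_le'.2 ⟨fun g hg => ?_, fun g hg => ?_⟩
      · exact le_abs_self (B x'') (R g) (hR g hg)
      · exact neg_le_abs (B x'') (R g) (hR g hg)
    exact h f hf

end Decomposition

/-! ### Norm estimates and truncations in the two sums. -/

namespace BanachSum

/-- In each coordinate `‖z n‖ ^ p ≤ ‖x n‖ ^ p + ‖y n‖ ^ p`, and summation gives `‖z‖ ^ p ≤ 2`. -/
theorem norm_lp_le_of_forall_or {F : ℕ → Type u} [∀ n, NormedAddCommGroup (F n)]
    {p : ℝ≥0∞} (hp : 0 < p.toReal) {x y z : lp F p} (hx : ‖x‖ ≤ 1)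
    (hy : ‖y‖ ≤ 1) (h : ∀ n, ‖z n‖ ≤ ‖x n‖ ∨ ‖z n‖ ≤ ‖y n‖) :
    ‖z‖ ≤ (2 : ℝ) ^ (1 / p.toReal) := by
  have h1 : ‖z‖ ^ p.toReal ≤ ‖x‖ ^ p.toReal + ‖y‖ ^ p.toReal :=
    hasSum_le (fun n => by
      have hx0 := Real.rpow_nonneg (norm_nonneg (x n)) p.toReal
      have hy0 := Real.rpow_nonneg (norm_nonneg (y n)) p.toReal
      rcases h n with h | h
      · linarith [Real.rpow_le_rpow (norm_nonneg _) h hp.le]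
      · linarith [Real.rpow_le_rpow (norm_nonneg _) h hp.le])
      (lp.hasSum_norm hp z) ((lp.hasSum_norm hp x).add (lp.hasSum_norm hp y))
  have hx1 := Real.rpow_le_one (lp.norm_nonneg' x) hx hp.le
  have hy1 := Real.rpow_le_one (lp.norm_nonneg' y) hy hp.le
  rw [one_div, ← Real.rpow_le_rpow_iff (lp.norm_nonneg' z) (by positivity) hp,
    Real.rpow_inv_rpow zero_le_two hp.ne']
  linarith

variable {F : ℕ → Type u} [∀ n, NormedAddCommGroup (F n)] [∀ n, NormedSpace ℝ (F n)]

/-- The coordinate functionals of `(⊕ Fₙ)ₚ`. -/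
noncomputable def coordLp (p : ℝ≥0∞) [Fact (1 ≤ p)] (n : ℕ) : lp F p →L[ℝ] F n :=
  LinearMap.mkContinuous { toFun := fun x => x n, map_add' := fun _ _ => rfl,
                           map_smul' := fun _ _ => rfl } 1 fun x => by
    rw [one_mul]
    exact lp.norm_apply_le_norm (zero_lt_one.trans_le Fact.out).ne' x n

/-- The inclusion of a summand into `(⊕ Fₙ)₀`. -/
noncomputable def inclC0 (n : ℕ) : F n →L[ℝ] c0Sum F :=
  (lp.singleContinuousLinearMap ℝ F ∞ n).codRestrict (c0Sum F) fun x => by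
    refine mem_c0Sum.2 (tendsto_const_nhds.congr' ?_)
    filter_upwards [eventually_gt_atTop n] with k hk
    change (0 : ℝ) = ‖lp.single ∞ n x k‖
    rw [lp.single_apply_ne _ _ _ hk.ne', norm_zero]

theorem single_nonneg [∀ n, Lattice (F n)] [∀ n, IsBanachLattice (F n)] (p : ℝ≥0∞) (n : ℕ)
    {x : F n} (hx : 0 ≤ x) : 0 ≤ lp.single p n x := fun k => by
  change 0 ≤ lp.single p n x k
  obtain rfl | hk := eq_or_ne k n
  · rwa [lp.single_apply_self]
  · rw [lp.single_apply_ne _ _ _ hk]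

/-- The truncation error has norm equal to the supremum of the tail, which tends to zero because `‖x
n‖ → 0`; this fails for general bounded sequences. -/
theorem tendsto_sum_inclC0 (x : c0Sum F) :
    Tendsto (fun N => ∑ k ∈ Finset.range N, inclC0 k ((x : lp F ∞) k)) atTop (𝓝 x) := by
  rw [Metric.tendsto_atTop]
  intro ε hε
  obtain ⟨N, hN⟩ := Metric.tendsto_atTop.1 (mem_c0Sum.1 x.2) (ε / 2) (half_pos hε)
  refine ⟨N, fun M hM => ?_⟩
  rw [dist_eq_norm]
  -- A supremum of terms below `ε / 2` is only known to be `≤ ε / 2`; the halving restores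
  -- strictness.
  refine lt_of_le_of_lt ?_ (half_lt_self hε)
  change ‖((∑ k ∈ Finset.range M, inclC0 k ((x : lp F ∞) k) - x : c0Sum F) : lp F ∞)‖ ≤ ε / 2
  refine lp.norm_le_of_forall_le (half_pos hε).le fun n => ?_
  have h : (((∑ k ∈ Finset.range M, inclC0 k ((x : lp F ∞) k) - x : c0Sum F) : lp F ∞) : ∀ n, F n) n
      = (∑ k ∈ Finset.range M, (Pi.single k ((x : lp F ∞) k) : ∀ n, F n) n) - (x : lp F ∞) n := by
    -- The coordinate is written as a linear map so that it passes through the finite sum.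
    change (coordLp ∞ n ∘L (c0Sum F).subtypeL) (_ - x) = _
    rw [map_sub, map_sum]
    rfl
  rw [h, Finset.sum_pi_single]
  split_ifs with hn
  · simpa using (half_pos hε).le
  · have h1 := hN n (hM.trans (not_lt.1 fun h' => hn (Finset.mem_range.2 h')))
    rw [dist_zero_right, norm_norm] at h1
    simpa using h1.le

end BanachSum

/-! ### The two direct sums. -/

theorem proposition3p8 (p : ℝ≥0∞) [Fact (1 ≤ p)] (hp₁ : 1 < p) (hp₂ : p < ∞)
    (F : ℕ → Type u) [∀ n, NormedAddCommGroup (F n)] [∀ n, NormedSpace ℝ (F n)]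
    [∀ n, Lattice (F n)] [∀ n, IsBanachLattice (F n)]
    (hF : ∀ n, AronBernerExtensionsAreRiesz.{u, v} (F n)) :
    AronBernerExtensionsAreRiesz.{u, v} (c0Sum F) ∧
      AronBernerExtensionsAreRiesz.{u, v} (lp F p) := by
  constructor
  · refine aronBernerExtensionsAreRiesz_of_coordinates
      (fun n => BanachSum.coordLp ∞ n ∘L (c0Sum F).subtypeL) BanachSum.inclC0 (fun n x => rfl)
      (fun n x hx => BanachSum.single_nonneg ∞ n hx) ?_ hF
    refine tendsto_sum_coordinates _ _ (fun n x => lp.single_apply_self ∞ n x)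
      (fun n k x h => lp.single_apply_ne ∞ k x h)
      (fun x y h => lp.norm_mono ENNReal.top_ne_zero h) BanachSum.tendsto_sum_inclC0
      -- Here `κ = 1`: in the supremum norm, gluing does not leave the unit ball.
      one_lt_two fun x y z hx hy h => ?_
    refine lp.norm_le_of_forall_le zero_le_one fun n => ?_
    have hxn := (lp.norm_apply_le_norm ENNReal.top_ne_zero (x : lp F ∞) n).trans hx
    have hyn := (lp.norm_apply_le_norm ENNReal.top_ne_zero (y : lp F ∞) n).trans hy
    exact (h n).elim (fun h => h.trans hxn) fun h => h.trans hyn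
  · have hp : 1 < p.toReal := by
      simpa using (ENNReal.toReal_lt_toReal ENNReal.one_ne_top hp₂.ne).2 hp₁
    have hp0 : p ≠ 0 := (zero_lt_one.trans hp₁).ne'
    refine aronBernerExtensionsAreRiesz_of_coordinates (BanachSum.coordLp p)
      (lp.singleContinuousLinearMap ℝ F p) (fun n x => rfl)
      (fun n x hx => BanachSum.single_nonneg p n hx) ?_ hF
    refine tendsto_sum_coordinates _ _ (fun n x => lp.single_apply_self p n x)
      (fun n k x h => lp.single_apply_ne p k x h) (fun x y h => lp.norm_mono hp0 h)
      -- Finiteness of `p` makes the finite truncations converge in norm.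
      (fun x => (lp.hasSum_single hp₂.ne x).tendsto_sum_nat) (κ := 2 ^ (1 / p.toReal)) ?_
      fun x y z hx hy h =>
        BanachSum.norm_lp_le_of_forall_or (zero_lt_one.trans hp) hx hy h
    -- The strict inequality `1 < p` is essential here: `2 ^ (1 / p) < 2` because `1 / p < 1`.
    exact Real.rpow_lt_self_of_one_lt one_lt_two ((div_lt_one (zero_lt_one.trans hp)).2 hp)
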